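/- Let $k$ be a field and $N \ge 0$ an integer. Let $\mathfrak b$ be the Lie algebra of all upper triangular matrices in $\mathfrak{sl}(N,k)$ (the Borel subalgebra) and $\mathfrak h \subseteq \mathfrak b$ the subalgebra of diagonal matrices of trace zero (the Cartan subalgebra). Let $H^n(\mathfrak b,k)$ be the $n$-th Chevalley–Eilenberg cohomology of $\mathfrak b$ with coefficients in the trivial module $k$. If the characteristic of $k$ is $0$ or greater than $N$, then $H^n(\mathfrak b,k) \cong (\bigwedge^n \mathfrak h)^*$ as $k$-vector spaces for all $n \ge 0$. The isomorphism is the natural one, which sends the class of an $n$-cocycle $F:\bigwedge^n \mathfrak b\to k$ to its restriction to $\bigwedge^n\mathfrak h$. -/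

import Mathlib

/-! Chevalley–Eilenberg cohomology of a Lie algebra with coefficients in a Lie module. -/

namespace LieCohomology

set_option linter.unusedSectionVars false

variable {R L M : Type*} [CommRing R] [LieRing L] [LieAlgebra R L]
  [AddCommGroup M] [Module R M] [LieRingModule L M] [LieModule R L M]

variable (R L M) in
/-- The module `C^n(L, M)` of `n`-cochains: alternating `n`-linear maps `L^n → M`,
i.e. linear maps `⋀^n L → M`. -/
abbrev Cochain (n : ℕ) : Type _ := L [⋀^Fin n]→ₗ[R] M

/-- For a cochain `F`, the linear map `x ↦ ((a_1, …, a_n) ↦ ⁅x, F (a_1, …, a_n)⁆)`. -/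
def lieComp (n : ℕ) (F : Cochain R L M n) : L →ₗ[R] Cochain R L M n where
  toFun x := (LieModule.toEnd R L M x : M →ₗ[R] M).compAlternatingMap F
  map_add' x y := by ext v; simp
  map_smul' c x := by ext v; simp

/-- The first sum of the coboundary,
`(a_0, …, a_n) ↦ ∑ i, (-1) ^ i • ⁅a_i, F (…, â_i, …)⁆`. -/
def actionPart (n : ℕ) : Cochain R L M n →ₗ[R] Cochain R L M (n + 1) where
  toFun F := AlternatingMap.alternatizeUncurryFin (lieComp n F)
  map_add' F G := by
    ext v; simp [AlternatingMap.alternatizeUncurryFin_apply, lieComp, Finset.sum_add_distrib]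
  map_smul' c F := by
    ext v
    simp [AlternatingMap.alternatizeUncurryFin_apply, lieComp, Finset.smul_sum, smul_comm _ c]

theorem actionPart_apply (n : ℕ) (F : Cochain R L M n) (a : Fin (n + 1) → L) :
    actionPart n F a = ∑ i : Fin (n + 1), (-1) ^ (i : ℕ) • ⁅a i, F (i.removeNth a)⁆ := by
  simp [actionPart, lieComp, AlternatingMap.alternatizeUncurryFin_apply]

/-- For an `(n + 1)`-cochain `F`, the bilinear map
`(x, y) ↦ ((a_1, …, a_n) ↦ F (⁅x, y⁆, a_1, …, a_n))`. -/
def bracketCurry (n : ℕ) (F : Cochain R L M (n + 1)) : L →ₗ[R] L →ₗ[R] Cochain R L M n :=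
  LinearMap.compr₂ (LieModule.toEnd R L L : L →ₗ[R] L →ₗ[R] L) F.curryLeft

theorem bracketCurry_apply (n : ℕ) (F : Cochain R L M (n + 1)) (x y : L) (a : Fin n → L) :
    bracketCurry n F x y a = F (Matrix.vecCons ⁅x, y⁆ a) := by
  simp [bracketCurry]

/-- The second sum of the coboundary of an `(n + 1)`-cochain, as a multilinear map. -/
def bracketMultilinear (n : ℕ) (F : Cochain R L M (n + 1)) :
    MultilinearMap R (fun _ : Fin (n + 2) => L) M :=
  ∑ i : Fin (n + 1), ∑ j ∈ Finset.Ici i, (-1) ^ ((i : ℕ) + ((j : ℕ) + 1)) •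
    LinearMap.uncurryMid i.castSucc
      ({ toFun := fun x =>
          LinearMap.uncurryMid j (AlternatingMap.toMultilinearMapLM ∘ₗ bracketCurry n F x)
         map_add' := fun x y => by ext v; simp
         map_smul' := fun c x => by ext v; simp } :
        L →ₗ[R] MultilinearMap R (fun _ : Fin (n + 1) => L) M)

/-- The index set of pairs `0 ≤ i < j ≤ n + 1` is parametrized by `(i.castSucc, j.succ)` with
`i ≤ j` in `Fin (n + 1)`; after the removal of the entry `i.castSucc` from the list, the entry
with index `j.succ` has index `j`. -/
theorem bracketMultilinear_apply (n : ℕ) (F : Cochain R L M (n + 1)) (a : Fin (n + 2) → L) :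
    bracketMultilinear n F a = ∑ i : Fin (n + 1), ∑ j ∈ Finset.Ici i,
      (-1) ^ ((i.castSucc : ℕ) + (j.succ : ℕ)) •
        F (Matrix.vecCons ⁅a i.castSucc, a j.succ⁆ (j.removeNth (i.castSucc.removeNth a))) := by
  simp only [bracketMultilinear, sum_apply, smul_apply]
  refine Finset.sum_congr rfl fun i _ => Finset.sum_congr rfl fun j hj => ?_
  have h : i.castSucc.removeNth a j = a j.succ := by
    rw [Finset.mem_Ici] at hj
    simp [Fin.removeNth_apply, Fin.succAbove_of_le_castSucc, hj]
  simp [bracketCurry_apply, h]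

theorem sum_lt_eq_zero {n : ℕ} (E : Fin n → Fin n → M) (S : Finset (Fin n))
    (hsymm : ∀ i j, E i j = E j i) (hdiag : ∀ i, E i i = 0)
    (hin : ∀ i ∈ S, ∀ j ∈ S, E i j = 0) (hout : ∀ i ∉ S, ∀ j ∉ S, E i j = 0)
    (hrow : ∀ i ∉ S, ∑ j, E i j = 0) :
    ∑ i, ∑ j, (if i < j then E i j else 0) = 0 := by
  classical
  have h1 : ∀ i j, (if i < j then E i j else 0) =
      (if i < j then (if i ∉ S then E i j else 0) else 0) +
      (if i < j then (if j ∉ S then E j i else 0) else 0) := by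
    intro i j
    by_cases hi : i ∈ S <;> by_cases hj : j ∈ S
    · simp [hi, hj, hin i hi j hj]
    · simp [hi, hj, hsymm i j]
    · simp [hi, hj]
    · simp [hi, hj, hout i hi j hj, hout j hj i hi]
  simp_rw [h1, Finset.sum_add_distrib]
  rw [Finset.sum_comm (f := fun i j => if i < j then (if j ∉ S then E j i else 0) else 0),
    ← Finset.sum_add_distrib]
  refine Finset.sum_eq_zero fun i _ => ?_
  rw [← Finset.sum_add_distrib]
  by_cases hi : i ∈ S
  · simp [hi]
  · refine Eq.trans ?_ (hrow i hi)
    refine Finset.sum_congr rfl fun j _ => ?_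
    rcases lt_trichotomy i j with h | h | h
    · simp [hi, h, h.not_gt]
    · subst h; simp [hdiag]
    · simp [hi, h, h.not_gt]

theorem bracketMultilinear_eq_zero (n : ℕ) (F : Cochain R L M (n + 1)) (a : Fin (n + 2) → L)
    (p q : Fin (n + 2)) (hapq : a p = a q) (hpq : p ≠ q) : bracketMultilinear n F a = 0 := by
  classical
  have hneg : ∀ x y v, bracketCurry n F y x v = - bracketCurry n F x y v := by
    intro x y v
    simp only [bracketCurry, LinearMap.compr₂_apply, LieHom.coe_toLinearMap,
      LieModule.toEnd_apply_apply]
    rw [← lie_skew, map_neg, AlternatingMap.neg_apply]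
  have hself : ∀ x v, bracketCurry n F x x v = 0 := by
    intro x v
    simp [bracketCurry]
  let A : Fin (n + 2) → Fin (n + 1) → M := fun i j =>
    (-1 : ℤ) ^ ((i : ℕ) + ((j : ℕ) + 1)) •
      bracketCurry n F (a i) (i.removeNth a j) (j.removeNth (i.removeNth a))
  have hA : ∀ i j, A (i.succAbove j) (j.predAbove i) = A i j := by
    intro i j
    have e1 : (i.succAbove j).removeNth a (j.predAbove i) = a i := by
      simp [Fin.removeNth_apply, Fin.succAbove_succAbove_predAbove]
    have e2 : (-1 : ℤ) ^ (((i.succAbove j : Fin _) : ℕ) + (((j.predAbove i : Fin _) : ℕ) + 1))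
        = - (-1) ^ ((i : ℕ) + ((j : ℕ) + 1)) := by
      have := Fin.neg_one_pow_succAbove_add_predAbove (R := ℤ) i j
      simp only [pow_add, pow_one] at this ⊢
      linarith
    simp only [A]
    rw [e1, e2, ← Fin.removeNth_removeNth_eq_swap, hneg, Fin.removeNth_apply i a j]
    simp
  let E : Fin (n + 2) → Fin (n + 2) → M := fun i => i.insertNth (α := fun _ => M) 0 (A i)
  have hE0 : ∀ i, E i i = 0 := fun i => by simp [E]
  have hE1 : ∀ i j, E i (i.succAbove j) = A i j := fun i j => by simp [E]
  have hsymm : ∀ i j, E i j = E j i := by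
    intro i j
    by_cases h : j = i
    · rw [h]
    · obtain ⟨j, rfl⟩ := Fin.exists_succAbove_eq h
      have h2 := hE1 (i.succAbove j) (j.predAbove i)
      rw [Fin.succAbove_succAbove_predAbove] at h2
      rw [h2, hE1, hA]
  have key := sum_lt_eq_zero E {p, q} hsymm hE0 ?_ ?_ ?_
  · rw [← key, Fin.sum_univ_castSucc, bracketMultilinear_apply]
    have hlast : ∑ j, (if Fin.last (n + 1) < j then E (Fin.last (n + 1)) j else 0) = 0 :=
      Finset.sum_eq_zero fun j _ => by simp [(Fin.le_last j).not_gt]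
    rw [hlast, add_zero]
    refine Finset.sum_congr rfl fun i _ => ?_
    rw [Fin.sum_univ_succ]
    simp only [Fin.not_lt_zero, if_false, zero_add, Fin.castSucc_lt_succ_iff]
    rw [← Finset.sum_filter]
    refine Finset.sum_congr (by ext; simp) fun j hj => ?_
    have hij : i ≤ j := by simpa using hj
    have h3 := hE1 i.castSucc j
    rw [Fin.succAbove_of_le_castSucc _ _ (Fin.castSucc_le_castSucc_iff.2 hij)] at h3
    rw [h3]
    simp only [A]
    rw [bracketCurry_apply, Fin.removeNth_apply i.castSucc a j,
      Fin.succAbove_of_le_castSucc _ _ (Fin.castSucc_le_castSucc_iff.2 hij)]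
    simp
  · intro i hi j hj
    by_cases h : j = i
    · rw [h, hE0]
    · have hij : a i = a j := by
        simp only [Finset.mem_insert, Finset.mem_singleton] at hi hj
        rcases hi with rfl | rfl <;> rcases hj with rfl | rfl <;>
          first | rfl | exact hapq | exact hapq.symm
      obtain ⟨j, rfl⟩ := Fin.exists_succAbove_eq h
      rw [hE1]
      simp only [A]
      rw [Fin.removeNth_apply i a j, ← hij, hself, smul_zero]
  · intro i hi j hj
    simp only [Finset.mem_insert, Finset.mem_singleton, not_or] at hi hj
    by_cases h : j = i
    · rw [h, hE0]
    · obtain ⟨j, rfl⟩ := Fin.exists_succAbove_eq h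
      obtain ⟨p, rfl⟩ := Fin.exists_succAbove_eq (Ne.symm hi.1)
      obtain ⟨q, rfl⟩ := Fin.exists_succAbove_eq (Ne.symm hi.2)
      obtain ⟨p, rfl⟩ := Fin.exists_succAbove_eq (x := p) (y := j) (fun h => hj.1 (by rw [h]))
      obtain ⟨q, rfl⟩ := Fin.exists_succAbove_eq (x := q) (y := j) (fun h => hj.2 (by rw [h]))
      rw [hE1]
      simp only [A]
      rw [AlternatingMap.map_eq_zero_of_eq _ _ (i := p) (j := q)
        hapq (fun h => hpq (by rw [h])), smul_zero]
  · intro i hi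
    simp only [Finset.mem_insert, Finset.mem_singleton, not_or] at hi
    rw [Fin.sum_univ_succAbove _ i, hE0, zero_add]
    simp only [hE1]
    obtain ⟨p, rfl⟩ := Fin.exists_succAbove_eq (Ne.symm hi.1)
    obtain ⟨q, rfl⟩ := Fin.exists_succAbove_eq (Ne.symm hi.2)
    have h4 := AlternatingMap.map_eq_zero_of_eq
      (AlternatingMap.alternatizeUncurryFin (bracketCurry n F (a i))) (i.removeNth a)
      (i := p) (j := q) (by simpa [Fin.removeNth_apply] using hapq) (fun h => hpq (by rw [h]))
    rw [AlternatingMap.alternatizeUncurryFin_apply] at h4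
    have h5 := congrArg (fun m => (-1 : ℤ) ^ ((i : ℕ) + 1) • m) h4
    simp only [Finset.smul_sum, smul_zero] at h5
    rw [← h5]
    refine Finset.sum_congr rfl fun j _ => ?_
    simp only [A]
    rw [show (i : ℕ) + ((j : ℕ) + 1) = ((i : ℕ) + 1) + (j : ℕ) by ring, pow_add _ _ (j : ℕ),
      mul_smul]

/-- The second sum of the coboundary of an `(n + 1)`-cochain,
`(a_0, …, a_{n+1}) ↦ ∑_{i < j} (-1) ^ (i + j) • F (⁅a_i, a_j⁆, …, â_i, …, â_j, …)`. -/
def bracketAlternating (n : ℕ) (F : Cochain R L M (n + 1)) : Cochain R L M (n + 2) :=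
  { bracketMultilinear n F with
    map_eq_zero_of_eq' := fun a p q h hpq => bracketMultilinear_eq_zero n F a p q h hpq }

theorem bracketAlternating_apply (n : ℕ) (F : Cochain R L M (n + 1)) (a : Fin (n + 2) → L) :
    bracketAlternating n F a = ∑ i : Fin (n + 1), ∑ j ∈ Finset.Ici i,
      (-1) ^ ((i.castSucc : ℕ) + (j.succ : ℕ)) •
        F (Matrix.vecCons ⁅a i.castSucc, a j.succ⁆ (j.removeNth (i.castSucc.removeNth a))) :=
  bracketMultilinear_apply n F a

/-- The second sum of the coboundary of an `n`-cochain (an empty sum for `n = 0`). -/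
def bracketPart : (n : ℕ) → Cochain R L M n →ₗ[R] Cochain R L M (n + 1)
  | 0 => 0
  | n + 1 =>
    { toFun := bracketAlternating n
      map_add' := fun F G => by
        ext a
        simp only [bracketAlternating_apply, AlternatingMap.add_apply, smul_add,
          Finset.sum_add_distrib]
      map_smul' := fun c F => by
        ext a
        simp only [bracketAlternating_apply, AlternatingMap.smul_apply, Finset.smul_sum,
          smul_comm _ c, RingHom.id_apply] }

variable (R L M) in
/-- The Chevalley–Eilenberg coboundary `δ : C^n(L, M) → C^(n+1)(L, M)`. -/
def coboundary (n : ℕ) : Cochain R L M n →ₗ[R] Cochain R L M (n + 1) :=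
  actionPart n + bracketPart n

theorem coboundary_zero_apply (F : Cochain R L M 0) (a : Fin 1 → L) :
    coboundary R L M 0 F a = ⁅a 0, F ![]⁆ := by
  simp [coboundary, bracketPart, actionPart_apply, Matrix.empty_eq]

theorem coboundary_succ_apply (n : ℕ) (F : Cochain R L M (n + 1)) (a : Fin (n + 2) → L) :
    coboundary R L M (n + 1) F a =
      ∑ i : Fin (n + 2), (-1) ^ (i : ℕ) • ⁅a i, F (i.removeNth a)⁆ +
      ∑ i : Fin (n + 1), ∑ j ∈ Finset.Ici i, (-1) ^ ((i.castSucc : ℕ) + (j.succ : ℕ)) •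
        F (Matrix.vecCons ⁅a i.castSucc, a j.succ⁆ (j.removeNth (i.castSucc.removeNth a))) := by
  rw [← bracketMultilinear_apply, ← actionPart_apply]
  rfl

variable (R L M) in
/-- The `n`-cocycles `Z^n(L, M)`. -/
def cocycles (n : ℕ) : Submodule R (Cochain R L M n) :=
  LinearMap.ker (coboundary R L M n)

variable (R L M) in
/-- The `n`-coboundaries `B^n(L, M)`. -/
def coboundaries : (n : ℕ) → Submodule R (Cochain R L M n)
  | 0 => ⊥
  | n + 1 => LinearMap.range (coboundary R L M n)

variable (R L M) in
/-- The `n`-th Chevalley–Eilenberg cohomology module `H^n(L, M) = Z^n(L, M) / B^n(L, M)`.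
Here `submoduleOf` regards `B^n(L, M)` as a submodule of `Z^n(L, M)`. -/
abbrev Cohomology (n : ℕ) : Type _ :=
  cocycles R L M n ⧸ (coboundaries R L M n).submoduleOf (cocycles R L M n)

end LieCohomology

section Borel

open LieAlgebra.SpecialLinear

variable (N : ℕ) (k : Type*) [Field k]

/-- The Borel subalgebra of `sl(N, k)`: the upper triangular matrices of trace zero. -/
def borelSubalgebra : LieSubalgebra k (sl (Fin N) k) where
  carrier := {A | ∀ i j, j < i → A.val i j = 0}
  add_mem' {A B} hA hB i j h := by simp [hA i j h, hB i j h]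
  zero_mem' i j h := by simp
  smul_mem' c A hA i j h := by simp [hA i j h]
  lie_mem' {A B} hA hB := by
    have hA' : A.val.BlockTriangular id := fun i j h => hA i j h
    have hB' : B.val.BlockTriangular id := fun i j h => hB i j h
    intro i j h
    rw [sl_bracket]
    exact ((hA'.mul hB').sub (hB'.mul hA')) h

/-- The Cartan subalgebra of `sl(N, k)`: the diagonal matrices of trace zero. -/
def cartanSubalgebra : LieSubalgebra k (sl (Fin N) k) where
  carrier := {A | ∀ i j, i ≠ j → A.val i j = 0}
  add_mem' {A B} hA hB i j h := by simp [hA i j h, hB i j h]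
  zero_mem' i j h := by simp
  smul_mem' c A hA i j h := by simp [hA i j h]
  lie_mem' {A B} hA hB := by
    have hA' : A.val.IsDiag := fun i j h => hA i j h
    have hB' : B.val.IsDiag := fun i j h => hB i j h
    intro i j h
    rw [sl_bracket, ← hA'.diagonal_diag, ← hB'.diagonal_diag]
    simp [Matrix.diagonal_mul_diagonal, h]

theorem cartanSubalgebra_le_borelSubalgebra : cartanSubalgebra N k ≤ borelSubalgebra N k :=
  fun _ hA i j h => hA i j h.ne'

/-- The field `k` as a trivial module over the Borel subalgebra. -/
instance borelTrivialLieRingModule : LieRingModule (borelSubalgebra N k) k where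
  bracket _ _ := 0
  add_lie _ _ _ := by simp
  lie_add _ _ _ := by simp
  leibniz_lie _ _ _ := by simp

instance borelTrivialIsTrivial : LieModule.IsTrivial (borelSubalgebra N k) k where
  trivial _ _ := rfl

instance borelTrivialLieModule : LieModule k (borelSubalgebra N k) k where
  smul_lie c _ _ := (mul_zero c).symm
  lie_smul c _ _ := (mul_zero c).symm

end Borel

/-!
Write `𝔟` for the Borel subalgebra and `𝔥` for the Cartan subalgebra. Restriction of cochains to `𝔥`
kills coboundaries, because `𝔥` is abelian, and it maps cocycles onto all alternating maps on `𝔥`,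
because the projection `𝔟 → 𝔥` kills brackets, so that pullbacks along it are cocycles. What has to
be shown is that a cocycle `F` that vanishes on `𝔥` is a coboundary.

By Cartan's formula (`coboundary_vecCons`) the Lie derivative along `x ∈ 𝔟` maps cocycles to
coboundaries. For `x` in `𝔥` it acts diagonally: on families of generators of `𝔟` (diagonal matrices
and matrix units `E_ab`, `a < b`) it is multiplication by the total weight of the family. Hence each
cocycle is cohomologous to a cocycle `G` annihilated by the Lie derivatives along finitely many
given `x` (`exists_cocycle_adDerivation_eq_zero`). Take for `x` the matrices `E_ii - 1 / N`. If `G`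
is nonzero at a family of distinct generators containing some `E_ab`, let `i` be the least such `a`:
the weight of the family at `E_ii - 1 / N` is the number of its members `E_ib`, which is between `1`
and `N` and therefore nonzero in `k`, by the assumption on the characteristic; a contradiction
(`apply_eq_zero_of_not_isDiag`). So `G` is determined by its restriction to `𝔥`, which is that of
`F`. If this is zero, then `G = 0` and `F` is a coboundary.
-/

/-! ### Linear algebra -/

/-- An alternating map vanishes as soon as it vanishes on injective families from a spanning set. -/
theorem AlternatingMap.eq_zero_of_span_eq_top {K V W ι : Type*} [Field K] [AddCommGroup V]
    [Module K V] [AddCommGroup W] [Module K W] [Finite ι] {S : Set V}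
    (hS : Submodule.span K S = ⊤) (F : V [⋀^ι]→ₗ[K] W)
    (h : ∀ v : ι → V, (∀ i, v i ∈ S) → Function.Injective v → F v = 0) : F = 0 := by
  let b := Module.Basis.ofSpan hS.ge
  refine b.ext_alternating fun v hv => ?_
  rw [AlternatingMap.zero_apply]
  exact h _ (fun i => Module.Basis.ofSpan_subset hS.ge ⟨v i, rfl⟩) (b.injective.comp hv)

theorem LinearMap.exists_quotientEquiv_of_surjective {K V W : Type*} [Field K] [AddCommGroup V]
    [Module K V] [AddCommGroup W] [Module K W] {f : V →ₗ[K] W} (hf : Function.Surjective f)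
    {B : Submodule K V} (hB : LinearMap.ker f = B) :
    ∃ e : (V ⧸ B) ≃ₗ[K] W, ∀ v, e (Submodule.Quotient.mk v) = f v := by
  subst hB
  exact ⟨f.quotKerEquivOfSurjective hf, fun v => f.quotKerEquivOfSurjective_apply_mk hf v⟩

theorem AlternatingMap.map_vecCons_vecCons_swap {R V W : Type*} [CommRing R] [AddCommGroup V]
    [Module R V] [AddCommGroup W] [Module R W] {n : ℕ} (F : V [⋀^Fin (n + 2)]→ₗ[R] W) (x y : V)
    (a : Fin n → V) :
    F (Matrix.vecCons x (Matrix.vecCons y a)) = -F (Matrix.vecCons y (Matrix.vecCons x a)) := by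
  rw [← F.map_swap _ (Fin.zero_ne_one (n := n))]
  congr 1
  funext l
  refine Fin.cases ?_ (fun l => Fin.cases ?_ (fun l => ?_) l) l
  · simp
  · simp
  · rw [Function.comp_apply, Equiv.swap_apply_of_ne_of_ne]
    · simp
    · exact Fin.succ_ne_zero _
    · exact fun h => Fin.succ_ne_zero l (Fin.succ_injective _ h)

/-- If `ker T ^ 2 = ker T` and `W` is `T`-stable, then `W` is the sum of `W ∩ ker T` and `T W`:
indeed `T` is injective, hence surjective, on `T W`. -/
theorem Module.End.exists_apply_sub_apply_eq_zero {K V : Type*} [Field K] [AddCommGroup V]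
    [Module K V] [FiniteDimensional K V] (T : Module.End K V) (W : Submodule K V)
    (hW : ∀ w ∈ W, T w ∈ W) (hT : ∀ v, T (T v) = 0 → T v = 0) {w : V} (hw : w ∈ W) :
    ∃ g ∈ W, T (w - T g) = 0 := by
  have hR : ∀ r ∈ W.map T, T r ∈ W.map T := by
    rintro _ ⟨g, hg, rfl⟩
    exact ⟨T g, hW g hg, rfl⟩
  have hinj : Function.Injective (T.restrict hR) := by
    rw [← LinearMap.ker_eq_bot, LinearMap.ker_eq_bot']
    rintro ⟨_, g, hg, rfl⟩ h0
    exact Subtype.ext (hT g (congrArg Subtype.val h0))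
  obtain ⟨⟨_, g, hg, rfl⟩, h⟩ := LinearMap.surjective_of_injective hinj ⟨T w, w, hw, rfl⟩
  refine ⟨g, hg, ?_⟩
  rw [map_sub, sub_eq_zero]
  exact (congrArg Subtype.val h).symm

namespace LieCohomology

variable {K L M : Type*} [Field K] [LieRing L] [LieAlgebra K L]
  [AddCommGroup M] [Module K M] [LieRingModule L M] [LieModule K L M]

instance finiteDimensional_cochain [FiniteDimensional K L] [FiniteDimensional K M] (n : ℕ) :
    FiniteDimensional K (Cochain K L M n) :=
  Module.Finite.equiv (exteriorPower.alternatingMapLinearEquiv (R := K) (M := L) (N := M)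
    (n := n)).symm

/-! ### The Lie derivative on cochains -/

variable (K L M) in
/-- The operator `F ↦ ((a_1, …, a_n) ↦ ∑ j, F (a_1, …, ⁅x, a_j⁆, …, a_n))` on `n`-cochains. For
trivial coefficients it is the negative of the Lie derivative along `x`. The entry `⁅x, a_j⁆` is
moved to the front, at the cost of the sign `(-1) ^ j`. -/
def adDerivation (x : L) : (n : ℕ) → Module.End K (Cochain K L M n)
  | 0 => 0
  | n + 1 =>
    { toFun := fun F => AlternatingMap.alternatizeUncurryFin (bracketCurry n F x)
      map_add' := fun F G => by
        ext a
        simp [AlternatingMap.alternatizeUncurryFin_apply, bracketCurry_apply,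
          Finset.sum_add_distrib]
      map_smul' := fun c F => by
        ext a
        simp [AlternatingMap.alternatizeUncurryFin_apply, bracketCurry_apply,
          Finset.smul_sum, smul_comm _ c] }

theorem adDerivation_succ_apply (x : L) (n : ℕ) (F : Cochain K L M (n + 1))
    (a : Fin (n + 1) → L) :
    adDerivation K L M x (n + 1) F a =
      ∑ j : Fin (n + 1), (-1) ^ (j : ℕ) • F (Matrix.vecCons ⁅x, a j⁆ (j.removeNth a)) := by
  change AlternatingMap.alternatizeUncurryFin (bracketCurry n F x) a = _
  simp [AlternatingMap.alternatizeUncurryFin_apply, bracketCurry_apply]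

/-- On a family of eigenvectors of `ad x`, the operator acts as multiplication by the sum of the
eigenvalues. -/
theorem adDerivation_apply_of_lie_eq_smul (x : L) {n : ℕ} (F : Cochain K L M n)
    (a : Fin n → L) (w : Fin n → K) (hw : ∀ j, ⁅x, a j⁆ = w j • a j) :
    adDerivation K L M x n F a = (∑ j, w j) • F a := by
  cases n with
  | zero => simp [adDerivation]
  | succ n =>
    rw [adDerivation_succ_apply, Finset.sum_smul]
    refine Finset.sum_congr rfl fun j _ => ?_
    have h := F.neg_one_pow_smul_map_insertNth j (a j) (j.removeNth a)
    rw [Fin.insertNth_self_removeNth] at h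
    rw [hw, AlternatingMap.map_vecCons_smul, smul_comm, ← h, smul_smul, ← mul_pow]
    simp

section IsTrivial

variable [LieModule.IsTrivial L M]

theorem coboundary_zero_eq_zero : coboundary K L M 0 = 0 := by
  ext F a
  rw [coboundary_zero_apply, trivial_lie_zero, LinearMap.zero_apply, AlternatingMap.zero_apply]

theorem coboundary_succ_apply_of_isTrivial (n : ℕ) (F : Cochain K L M (n + 1))
    (a : Fin (n + 2) → L) :
    coboundary K L M (n + 1) F a =
      ∑ i : Fin (n + 1), ∑ j ∈ Finset.Ici i, (-1) ^ ((i.castSucc : ℕ) + (j.succ : ℕ)) •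
        F (Matrix.vecCons ⁅a i.castSucc, a j.succ⁆ (j.removeNth (i.castSucc.removeNth a))) := by
  simp [coboundary_succ_apply, trivial_lie_zero L M]

/-- Cartan's formula `ι_x δ F = - adDerivation x F - δ ι_x F` for trivial coefficients. -/
theorem coboundary_vecCons (x : L) (n : ℕ) (F : Cochain K L M (n + 1)) (a : Fin (n + 1) → L) :
    coboundary K L M (n + 1) F (Matrix.vecCons x a) =
      - adDerivation K L M x (n + 1) F a - coboundary K L M n (F.curryLeft x) a := by
  rw [coboundary_succ_apply_of_isTrivial, adDerivation_succ_apply, Fin.sum_univ_succ,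
    sub_eq_add_neg]
  congr 1
  · rw [← Finset.sum_neg_distrib]
    have h0 : Finset.Ici (0 : Fin (n + 1)) = Finset.univ := by ext; simp
    rw [h0]
    refine Finset.sum_congr rfl fun j _ => ?_
    simp [pow_succ, Fin.removeNth_zero]
  · cases n with
    | zero => simp [coboundary_zero_eq_zero]
    | succ n =>
      rw [coboundary_succ_apply_of_isTrivial, ← Finset.sum_neg_distrib]
      refine Finset.sum_congr rfl fun i _ => ?_
      rw [← Finset.sum_neg_distrib, ← Fin.map_succEmb_Ici, Finset.sum_map]
      refine Finset.sum_congr rfl fun j _ => ?_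
      have hrem : (j.succ.removeNth (i.succ.castSucc.removeNth (Matrix.vecCons x a))) =
          Matrix.vecCons x (j.removeNth (i.castSucc.removeNth a)) := by
        funext l
        refine Fin.cases ?_ (fun l => ?_) l <;>
          simp [Fin.removeNth_apply]
      rw [Fin.coe_succEmb, hrem, AlternatingMap.map_vecCons_vecCons_swap, ← Fin.succ_castSucc]
      simp only [Matrix.cons_val_succ, Fin.val_succ, AlternatingMap.curryLeft_apply_apply]
      rw [smul_neg, show (i.castSucc : ℕ) + 1 + (j + 1 + 1) = i.castSucc + (j + 1) + 2 by ring,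
        pow_add _ _ 2]
      simp

theorem adDerivation_mem_coboundaries (x : L) {n : ℕ} {F : Cochain K L M n}
    (hF : F ∈ cocycles K L M n) : adDerivation K L M x n F ∈ coboundaries K L M n := by
  cases n with
  | zero => simp [adDerivation]
  | succ n =>
    refine ⟨-F.curryLeft x, ?_⟩
    ext a
    have h := coboundary_vecCons x n F a
    rw [show coboundary K L M (n + 1) F = 0 from hF, AlternatingMap.zero_apply] at h
    rw [map_neg, AlternatingMap.neg_apply]
    exact neg_eq_iff_eq_neg.2 (sub_eq_zero.1 h.symm).symm

end IsTrivial

variable {S : Set L}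

/-- Since `S` spans `L`, cochains may be compared on families from `S`, on which both operators
act by scalars. -/
theorem adDerivation_comm (hS : Submodule.span K S = ⊤) {x y : L}
    (hx : ∀ s ∈ S, ∃ c : K, ⁅x, s⁆ = c • s) (hy : ∀ s ∈ S, ∃ c : K, ⁅y, s⁆ = c • s)
    (n : ℕ) (F : Cochain K L M n) :
    adDerivation K L M x n (adDerivation K L M y n F) =
      adDerivation K L M y n (adDerivation K L M x n F) := by
  rw [← sub_eq_zero]
  refine AlternatingMap.eq_zero_of_span_eq_top hS _ fun v hv _ => ?_
  choose c hc using fun i => hx (v i) (hv i)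
  choose d hd using fun i => hy (v i) (hv i)
  rw [AlternatingMap.sub_apply, adDerivation_apply_of_lie_eq_smul x _ v c hc,
    adDerivation_apply_of_lie_eq_smul y _ v d hd, adDerivation_apply_of_lie_eq_smul y _ v d hd,
    adDerivation_apply_of_lie_eq_smul x _ v c hc, smul_comm, sub_self]

/-- The operator acts by scalars on the values at families of eigenvectors, so its kernel and its
range meet trivially. -/
theorem adDerivation_eq_zero_of_sq (hS : Submodule.span K S = ⊤) {x : L}
    (hx : ∀ s ∈ S, ∃ c : K, ⁅x, s⁆ = c • s) (n : ℕ) (F : Cochain K L M n)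
    (h : adDerivation K L M x n (adDerivation K L M x n F) = 0) :
    adDerivation K L M x n F = 0 := by
  refine AlternatingMap.eq_zero_of_span_eq_top hS _ fun v hv _ => ?_
  choose c hc using fun i => hx (v i) (hv i)
  have h1 := DFunLike.congr_fun h v
  rw [adDerivation_apply_of_lie_eq_smul x _ v c hc, AlternatingMap.zero_apply,
    smul_eq_zero] at h1
  rcases h1 with h1 | h1
  · rw [adDerivation_apply_of_lie_eq_smul x _ v c hc, h1, zero_smul]
  · exact h1

variable [LieModule.IsTrivial L M]

/-- The coboundary preserves weights: `δ F` at a family of eigenvectors only involves values of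
`F` at families of eigenvectors with the same sum of eigenvalues. In particular `adDerivation x`
preserves cocycles. -/
theorem coboundary_adDerivation (hS : Submodule.span K S = ⊤) {x : L}
    (hx : ∀ s ∈ S, ∃ c : K, ⁅x, s⁆ = c • s) (n : ℕ) (F : Cochain K L M n) :
    coboundary K L M n (adDerivation K L M x n F) =
      adDerivation K L M x (n + 1) (coboundary K L M n F) := by
  cases n with
  | zero => simp [coboundary_zero_eq_zero]
  | succ n =>
    rw [← sub_eq_zero]
    refine AlternatingMap.eq_zero_of_span_eq_top hS _ fun v hv _ => ?_
    choose c hc using fun i => hx (v i) (hv i)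
    rw [AlternatingMap.sub_apply, sub_eq_zero,
      adDerivation_apply_of_lie_eq_smul x _ v c hc, coboundary_succ_apply_of_isTrivial,
      coboundary_succ_apply_of_isTrivial, Finset.smul_sum]
    refine Finset.sum_congr rfl fun i _ => ?_
    rw [Finset.smul_sum]
    refine Finset.sum_congr rfl fun j hj => ?_
    have hij : i.castSucc.succAbove j = j.succ :=
      Fin.succAbove_of_le_castSucc _ _ (Fin.castSucc_le_castSucc_iff.2 (Finset.mem_Ici.1 hj))
    -- the bracket of two eigenvectors is an eigenvector for the sum of the eigenvalues
    have hlie : ⁅x, ⁅v i.castSucc, v j.succ⁆⁆ =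
        (c i.castSucc + c j.succ) • ⁅v i.castSucc, v j.succ⁆ := by
      rw [leibniz_lie, hc, hc, smul_lie, lie_smul, add_smul]
    rw [adDerivation_apply_of_lie_eq_smul x F _
      (Matrix.vecCons (c i.castSucc + c j.succ) (j.removeNth (i.castSucc.removeNth c)))]
    · rw [smul_comm, Fin.sum_univ_succ (n := n), Fin.sum_univ_succAbove c i.castSucc,
        Fin.sum_univ_succAbove _ j, hij]
      simp [Fin.removeNth_apply, add_assoc]
    · refine Fin.cases ?_ fun l => ?_
      · simpa using hlie
      · simp [Fin.removeNth_apply, hc]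

/-- Every cocycle is cohomologous to one that is annihilated by `adDerivation x` for the finitely
many `x = t i`, if these act diagonalizably on `L` with a common spanning set of eigenvectors. -/
theorem exists_cocycle_adDerivation_eq_zero [FiniteDimensional K L] [FiniteDimensional K M]
    (hS : Submodule.span K S = ⊤) {ι : Type*} (t : ι → L)
    (ht : ∀ i, ∀ s ∈ S, ∃ c : K, ⁅t i, s⁆ = c • s) (n : ℕ) (I : Finset ι)
    {F : Cochain K L M n} (hF : F ∈ cocycles K L M n) :
    ∃ G ∈ cocycles K L M n, F - G ∈ coboundaries K L M n ∧
      ∀ i ∈ I, adDerivation K L M (t i) n G = 0 := by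
  classical
  induction I using Finset.induction_on with
  | empty => exact ⟨F, hF, by simp, by simp⟩
  | insert i I _ ih =>
    obtain ⟨G, hG, hFG, hGI⟩ := ih
    -- the induction step stays inside the cocycles annihilated by the previous operators
    let W : Submodule K (Cochain K L M n) :=
      cocycles K L M n ⊓ ⨅ j ∈ I, LinearMap.ker (adDerivation K L M (t j) n)
    have hmem : ∀ H, H ∈ W ↔ H ∈ cocycles K L M n ∧
        ∀ j ∈ I, adDerivation K L M (t j) n H = 0 := fun H => by simp [W]
    have hW : ∀ H ∈ W, adDerivation K L M (t i) n H ∈ W := by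
      intro H hH
      rw [hmem] at hH ⊢
      refine ⟨?_, fun j hj => ?_⟩
      · change coboundary K L M n _ = 0
        rw [coboundary_adDerivation hS (ht i), show coboundary K L M n H = 0 from hH.1, map_zero]
      · rw [adDerivation_comm hS (ht j) (ht i), hH.2 j hj, map_zero]
    obtain ⟨H, hH, h0⟩ := Module.End.exists_apply_sub_apply_eq_zero _ W hW
      (adDerivation_eq_zero_of_sq hS (ht i) n) ((hmem G).2 ⟨hG, hGI⟩)
    have h1 := (hmem _).1 (W.sub_mem ((hmem G).2 ⟨hG, hGI⟩) (hW H hH))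
    refine ⟨_, h1.1, ?_, fun j hj => ?_⟩
    · rw [sub_sub_eq_add_sub, add_sub_right_comm]
      exact Submodule.add_mem _ hFG (adDerivation_mem_coboundaries _ ((hmem H).1 hH).1)
    · rcases Finset.mem_insert.1 hj with rfl | hj
      · exact h0
      · exact h1.2 j hj

end LieCohomology

/-! ### The Borel subalgebra -/

section

open LieAlgebra.SpecialLinear LieCohomology

variable {N : ℕ} {k : Type*} [Field k]

@[ext]
theorem borelSubalgebra_ext {A B : borelSubalgebra N k} (h : ∀ i j, A.val.val i j = B.val.val i j) :
    A = B :=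
  Subtype.ext (Subtype.ext (Matrix.ext h))

theorem lie_borelSubalgebra_val (A B : borelSubalgebra N k) :
    ⁅A, B⁆.val.val = A.val.val * B.val.val - B.val.val * A.val.val := rfl

variable (N k) in
/-- The projection of the Borel subalgebra to the Cartan subalgebra that keeps the diagonal. -/
def borelToCartan : borelSubalgebra N k →ₗ[k] cartanSubalgebra N k where
  toFun A := ⟨⟨Matrix.diagonal A.val.val.diag, by
    have h : Matrix.trace A.val.val = 0 := A.val.2
    change Matrix.trace (Matrix.diagonal A.val.val.diag) = 0
    rwa [Matrix.trace_diagonal]⟩, fun i j h => Matrix.diagonal_apply_ne _ h⟩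
  map_add' A B := by
    refine Subtype.ext (Subtype.ext ?_)
    exact (Matrix.diagonal_add _ _).symm
  map_smul' c A := by
    refine Subtype.ext (Subtype.ext ?_)
    exact Matrix.diagonal_smul c A.val.val.diag

theorem borelToCartan_val (A : borelSubalgebra N k) :
    (borelToCartan N k A).val.val = Matrix.diagonal A.val.val.diag := rfl

theorem borelToCartan_inclusion (h : cartanSubalgebra N k) : borelToCartan N k
    (LieSubalgebra.inclusion (cartanSubalgebra_le_borelSubalgebra N k) h) = h := by
  have hd : h.val.val.IsDiag := fun i j hij => h.2 i j hij
  exact Subtype.ext (Subtype.ext hd.diagonal_diag)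

/-- The diagonal of a product of upper triangular matrices is multiplicative, so the projection to
the Cartan subalgebra kills brackets. -/
theorem borelToCartan_lie (A B : borelSubalgebra N k) : borelToCartan N k ⁅A, B⁆ = 0 := by
  have hdiag : ∀ (X Y : borelSubalgebra N k) (i : Fin N),
      (X.val.val * Y.val.val) i i = X.val.val i i * Y.val.val i i := by
    intro X Y i
    rw [Matrix.mul_apply]
    refine Finset.sum_eq_single i (fun j _ hj => ?_) (by simp)
    rcases lt_or_gt_of_ne hj with h | h
    · rw [X.2 i j h, zero_mul]
    · rw [Y.2 j i h, mul_zero]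
  refine Subtype.ext (Subtype.ext ?_)
  rw [borelToCartan_val, lie_borelSubalgebra_val]
  ext i j
  rw [Matrix.diagonal_apply]
  split_ifs
  · simp [hdiag, mul_comm]
  · rfl

variable (N k) in
/-- The diagonal matrices and the matrix units above the diagonal, as elements of the Borel
subalgebra. -/
def borelGenerators : Set (borelSubalgebra N k) :=
  {A | A.val.val.IsDiag} ∪ {A | ∃ a b, a < b ∧ A.val.val = Matrix.single a b 1}

theorem span_borelGenerators : Submodule.span k (borelGenerators N k) = ⊤ := by
  rw [eq_top_iff]
  rintro A -
  let E : {p : Fin N × Fin N // p.1 < p.2} → borelSubalgebra N k := fun p =>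
    ⟨LieAlgebra.SpecialLinear.single p.1.1 p.1.2 p.2.ne 1, fun i j hji => by
      rw [val_single, Matrix.single_apply_of_ne]
      rintro ⟨hi, hj⟩
      exact absurd p.2 (by rw [hi, hj]; exact hji.not_gt)⟩
  have hE : ∀ p i j, (E p).val.val i j = if p.1 = (i, j) then 1 else 0 := by
    intro p i j
    change Matrix.single p.1.1 p.1.2 (1 : k) i j = _
    rw [Matrix.single_apply]
    exact if_congr (Prod.ext_iff (x := p.1) (y := (i, j))).symm rfl rfl
  have hA : A = LieSubalgebra.inclusion (cartanSubalgebra_le_borelSubalgebra N k)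
      (borelToCartan N k A) + ∑ p, A.val.val p.1.1 p.1.2 • E p := by
    let entry (i j : Fin N) : borelSubalgebra N k →ₗ[k] k :=
      { toFun := fun B => B.val.val i j, map_add' := fun _ _ => rfl, map_smul' := fun _ _ => rfl }
    ext i j
    change entry i j A = entry i j (LieSubalgebra.inclusion
      (cartanSubalgebra_le_borelSubalgebra N k) (borelToCartan N k A) +
        ∑ p, A.val.val p.1.1 p.1.2 • E p)
    rw [map_add, map_sum]
    have h1 : entry i j (LieSubalgebra.inclusion (cartanSubalgebra_le_borelSubalgebra N k)
        (borelToCartan N k A)) = if i = j then A.val.val i i else 0 := Matrix.diagonal_apply _ _ _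
    have h2 : ∀ p, entry i j (A.val.val p.1.1 p.1.2 • E p) =
        if p.1 = (i, j) then A.val.val i j else 0 := by
      intro p
      rw [map_smul, smul_eq_mul]
      change _ * (E p).val.val i j = _
      rw [hE]
      split_ifs with h
      · rw [h, mul_one]
      · rw [mul_zero]
    simp_rw [h1, h2]
    change A.val.val i j = _
    rcases lt_trichotomy i j with h | rfl | h
    · rw [if_neg h.ne, zero_add, Finset.sum_eq_single ⟨(i, j), h⟩ _ (by simp), if_pos rfl]
      exact fun p _ hp => if_neg fun hp' => hp (Subtype.ext hp')
    · rw [if_pos rfl, Finset.sum_eq_zero, add_zero]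
      exact fun p _ => if_neg fun hp => p.2.ne (by rw [hp])
    · rw [if_neg h.ne', Finset.sum_eq_zero, add_zero, A.2 i j h]
      exact fun p _ => if_neg fun hp => p.2.not_gt (by rw [hp]; exact h)
  rw [hA]
  refine Submodule.add_mem _ (Submodule.subset_span (Or.inl ?_)) (Submodule.sum_mem _ fun p _ =>
    Submodule.smul_mem _ _ (Submodule.subset_span (Or.inr ⟨p.1.1, p.1.2, p.2, rfl⟩)))
  exact fun i j hij => (borelToCartan N k A).2 i j hij

/-- The traceless matrix `E_ii - 1 / N`, whose adjoint action agrees with that of the matrix unit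
`E_ii`. It requires `N` to be invertible in `k`. -/
def tracelessDiagonalUnit (hN : (N : k) ≠ 0) (i : Fin N) : borelSubalgebra N k :=
  ⟨⟨Matrix.diagonal (fun j => (Pi.single i 1 : Fin N → k) j - (N : k)⁻¹), by
    change Matrix.trace (Matrix.diagonal fun j => (Pi.single i 1 : Fin N → k) j - (N : k)⁻¹) = 0
    rw [Matrix.trace_diagonal]
    simp [Finset.sum_pi_single', hN]⟩, fun _ _ h => Matrix.diagonal_apply_ne _ h.ne'⟩

theorem tracelessDiagonalUnit_lie_isDiag (hN : (N : k) ≠ 0) (i : Fin N) {A : borelSubalgebra N k}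
    (hA : A.val.val.IsDiag) : ⁅tracelessDiagonalUnit hN i, A⁆ = (0 : k) • A := by
  refine Subtype.ext (Subtype.ext ?_)
  rw [lie_borelSubalgebra_val, zero_smul, ← hA.diagonal_diag]
  simp [tracelessDiagonalUnit, Matrix.diagonal_mul_diagonal, mul_comm]

theorem tracelessDiagonalUnit_lie_single (hN : (N : k) ≠ 0) (i : Fin N)
    {A : borelSubalgebra N k} {a b : Fin N} (hA : A.val.val = Matrix.single a b 1) :
    ⁅tracelessDiagonalUnit hN i, A⁆ =
      ((Pi.single i 1 : Fin N → k) a - (Pi.single i 1 : Fin N → k) b) • A := by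
  refine Subtype.ext (Subtype.ext ?_)
  rw [lie_borelSubalgebra_val]
  change _ = _ • A.val.val
  rw [hA]
  ext c d
  simp only [tracelessDiagonalUnit, Matrix.sub_apply, Matrix.diagonal_mul, Matrix.mul_diagonal,
    Matrix.smul_apply, smul_eq_mul, Matrix.single_apply]
  split_ifs with h
  · rw [← h.1, ← h.2]
    ring
  · ring

theorem exists_tracelessDiagonalUnit_lie (hN : (N : k) ≠ 0) (i : Fin N) :
    ∀ A ∈ borelGenerators N k, ∃ c : k, ⁅tracelessDiagonalUnit hN i, A⁆ = c • A := by
  rintro A (hA | ⟨a, b, -, hA⟩)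
  · exact ⟨_, tracelessDiagonalUnit_lie_isDiag hN i hA⟩
  · exact ⟨_, tracelessDiagonalUnit_lie_single hN i hA⟩

/-- A cochain of weight zero vanishes on distinct generators that are not all diagonal. Let `i` be
the least row of the matrix units `E_ab` among them. None of these has column `i`, so the weight at
`i` is the number of those with row `i`, which lies strictly between `0` and `N`. -/
theorem apply_eq_zero_of_not_isDiag (hk : ∀ c : ℕ, 0 < c → c ≤ N → (c : k) ≠ 0)
    (hN : (N : k) ≠ 0) {n : ℕ} {F : Cochain k (borelSubalgebra N k) k n}
    (hF : ∀ i, adDerivation k (borelSubalgebra N k) k (tracelessDiagonalUnit hN i) n F = 0)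
    (v : Fin n → borelSubalgebra N k) (hv : ∀ j, v j ∈ borelGenerators N k)
    (hinj : Function.Injective v) (hdiag : ¬ ∀ j, (v j).val.val.IsDiag) : F v = 0 := by
  classical
  obtain ⟨j₀, hj₀⟩ := not_forall.1 hdiag
  have h1 : ∀ j, ∃ p : Fin N × Fin N, ¬ (v j).val.val.IsDiag →
      p.1 < p.2 ∧ (v j).val.val = Matrix.single p.1 p.2 1 := by
    intro j
    rcases hv j with h | ⟨a, b, h⟩
    · obtain h0 | ⟨a, b, -⟩ := hv j₀
      · exact absurd h0 hj₀
      · exact ⟨(a, b), fun h' => absurd h h'⟩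
    · exact ⟨(a, b), fun _ => h⟩
  choose p hlt hp using h1
  let J : Finset (Fin n) := {j | ¬ (v j).val.val.IsDiag}
  have hJ : ∀ {j}, j ∈ J ↔ ¬ (v j).val.val.IsDiag := by simp [J]
  obtain ⟨m, hm, hmin⟩ := J.exists_min_image (fun j => (p j).1) ⟨j₀, hJ.2 hj₀⟩
  have hcol : ∀ j ∈ J, (p m).1 < (p j).2 := fun j hj => (hmin j hj).trans_lt (hlt j (hJ.1 hj))
  let J' : Finset (Fin n) := {j ∈ J | (p j).1 = (p m).1}
  have hpos : 0 < J'.card := Finset.card_pos.2 ⟨m, by simp [J', hm]⟩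
  have hle : J'.card ≤ N := by
    rw [← Fintype.card_fin N]
    refine Finset.card_le_card_of_injOn (fun j => (p j).2) (by simp) fun x hx y hy hxy => ?_
    simp only [J', Finset.coe_filter, Set.mem_ofPred_eq] at hx hy
    refine hinj (Subtype.ext (Subtype.ext ?_))
    rw [hp x (hJ.1 hx.1), hp y (hJ.1 hy.1), hx.2, hy.2, show (p x).2 = (p y).2 from hxy]
  have hw : ∀ j, ⁅tracelessDiagonalUnit hN (p m).1, v j⁆ =
      (if j ∈ J' then 1 else 0 : k) • v j := by
    intro j
    by_cases hj : j ∈ J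
    · rw [tracelessDiagonalUnit_lie_single hN _ (hp j (hJ.1 hj)),
        Pi.single_eq_of_ne (hcol j hj).ne', sub_zero, Pi.single_apply]
      simp [J', hj]
    · rw [tracelessDiagonalUnit_lie_isDiag hN _ (not_not.1 (mt hJ.2 hj))]
      simp [J', hj]
  have h2 := adDerivation_apply_of_lie_eq_smul _ F v _ hw
  rw [hF, AlternatingMap.zero_apply] at h2
  refine (smul_eq_zero.1 h2.symm).resolve_left ?_
  rw [Finset.sum_boole, Finset.filter_mem_eq_inter, Finset.univ_inter]
  exact hk _ hpos hle

/-! ### Restriction to the Cartan subalgebra -/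

variable (N k) in
/-- The restriction of cochains from the Borel subalgebra to the Cartan subalgebra. -/
def restrictCartan (n : ℕ) :
    Cochain k (borelSubalgebra N k) k n →ₗ[k] cartanSubalgebra N k [⋀^Fin n]→ₗ[k] k where
  toFun F := F.compLinearMap
    (LieSubalgebra.inclusion (cartanSubalgebra_le_borelSubalgebra N k) :
      cartanSubalgebra N k →ₗ[k] borelSubalgebra N k)
  map_add' _ _ := rfl
  map_smul' _ _ := rfl

theorem restrictCartan_apply (n : ℕ) (F : Cochain k (borelSubalgebra N k) k n)
    (h : Fin n → cartanSubalgebra N k) : restrictCartan N k n F h =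
      F (fun i => LieSubalgebra.inclusion (cartanSubalgebra_le_borelSubalgebra N k) (h i)) := rfl

theorem inclusion_lie_inclusion (g h : cartanSubalgebra N k) :
    ⁅LieSubalgebra.inclusion (cartanSubalgebra_le_borelSubalgebra N k) g,
      LieSubalgebra.inclusion (cartanSubalgebra_le_borelSubalgebra N k) h⁆ = 0 := by
  have hg : g.val.val.IsDiag := fun i j hij => g.2 i j hij
  have hh : h.val.val.IsDiag := fun i j hij => h.2 i j hij
  refine Subtype.ext (Subtype.ext ?_)
  rw [lie_borelSubalgebra_val]
  change g.val.val * h.val.val - h.val.val * g.val.val = 0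
  rw [← hg.diagonal_diag, ← hh.diagonal_diag]
  simp [Matrix.diagonal_mul_diagonal, mul_comm]

theorem restrictCartan_eq_zero_of_mem_coboundaries {n : ℕ}
    {F : Cochain k (borelSubalgebra N k) k n}
    (hF : F ∈ coboundaries k (borelSubalgebra N k) k n) : restrictCartan N k n F = 0 := by
  cases n with
  | zero =>
    rw [show F = 0 from hF, map_zero]
  | succ n =>
    obtain ⟨G, rfl⟩ := hF
    ext h
    rw [restrictCartan_apply, AlternatingMap.zero_apply]
    cases n with
    | zero => rw [coboundary_zero_eq_zero]; rfl
    | succ n =>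
      rw [coboundary_succ_apply_of_isTrivial]
      refine Finset.sum_eq_zero fun i _ => Finset.sum_eq_zero fun j _ => ?_
      rw [inclusion_lie_inclusion, G.map_coord_zero 0 (by simp), smul_zero]

/-- The pullback along `borelToCartan` extends every alternating map to a cocycle. -/
theorem compLinearMap_borelToCartan_mem_cocycles {n : ℕ}
    (G : cartanSubalgebra N k [⋀^Fin n]→ₗ[k] k) :
    G.compLinearMap (borelToCartan N k) ∈ cocycles k (borelSubalgebra N k) k n := by
  change coboundary _ _ _ _ _ = 0
  cases n with
  | zero => rw [coboundary_zero_eq_zero]; rfl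
  | succ n =>
    ext a
    rw [coboundary_succ_apply_of_isTrivial, AlternatingMap.zero_apply]
    refine Finset.sum_eq_zero fun i _ => Finset.sum_eq_zero fun j _ => ?_
    rw [AlternatingMap.compLinearMap_apply, G.map_coord_zero 0, smul_zero]
    simp [borelToCartan_lie]

/-- Modulo coboundaries the cocycle may be taken of weight zero; it then vanishes on all families
of generators, on the diagonal ones by assumption and on the others by weight. -/
theorem mem_coboundaries_of_restrictCartan_eq_zero
    (hk : ∀ c : ℕ, 0 < c → c ≤ N → (c : k) ≠ 0) {n : ℕ}
    {F : Cochain k (borelSubalgebra N k) k n}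
    (hF : F ∈ cocycles k (borelSubalgebra N k) k n) (h0 : restrictCartan N k n F = 0) :
    F ∈ coboundaries k (borelSubalgebra N k) k n := by
  have hvanish : ∀ G : Cochain k (borelSubalgebra N k) k n, restrictCartan N k n G = 0 →
      ∀ v : Fin n → borelSubalgebra N k, (∀ j, (v j).val.val.IsDiag) → G v = 0 := by
    intro G hG v hv
    have h := restrictCartan_apply n G fun j => ⟨(v j).val, fun i l hil => hv j hil⟩
    rw [hG] at h
    exact h.symm
  -- for `N = 0`, where `N` is not invertible in `k`, every matrix is diagonal
  rcases N.eq_zero_or_pos with rfl | hpos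
  · have hF0 : F = 0 := by
      ext v
      exact hvanish F h0 v fun j i => i.elim0
    rw [hF0]
    exact Submodule.zero_mem _
  have hN : (N : k) ≠ 0 := hk N hpos le_rfl
  obtain ⟨G, -, hFG, hG⟩ := exists_cocycle_adDerivation_eq_zero span_borelGenerators
    (tracelessDiagonalUnit hN) (exists_tracelessDiagonalUnit_lie hN) n Finset.univ hF
  have hres := restrictCartan_eq_zero_of_mem_coboundaries hFG
  rw [map_sub, h0, zero_sub, neg_eq_zero] at hres
  have hG0 : G = 0 := by
    refine AlternatingMap.eq_zero_of_span_eq_top span_borelGenerators _ fun v hv hinj => ?_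
    by_cases hdiag : ∀ j, (v j).val.val.IsDiag
    · exact hvanish G hres v hdiag
    · exact apply_eq_zero_of_not_isDiag hk hN (fun i => hG i (Finset.mem_univ i)) v hv hinj hdiag
  rwa [hG0, sub_zero] at hFG

theorem natCast_ne_zero_of_le (p : ℕ) [CharP k p] (hp : p = 0 ∨ N < p) (c : ℕ) (h0 : 0 < c)
    (hc : c ≤ N) : (c : k) ≠ 0 := by
  rw [Ne, CharP.cast_eq_zero_iff k p]
  intro h
  rcases hp with rfl | hp
  · exact h0.ne' (zero_dvd_iff.1 h)
  · exact absurd (Nat.le_of_dvd h0 h) (by omega)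

variable (N k) in
/-- The restriction of cocycles to the Cartan subalgebra, as a linear form on its exterior power. -/
noncomputable def restrictCocycle (n : ℕ) : cocycles k (borelSubalgebra N k) k n →ₗ[k]
    Module.Dual k (⋀[k]^n (cartanSubalgebra N k)) :=
  (exteriorPower.alternatingMapLinearEquiv (R := k) (M := cartanSubalgebra N k) (N := k)
    (n := n)).toLinearMap ∘ₗ restrictCartan N k n ∘ₗ
      (cocycles k (borelSubalgebra N k) k n).subtype

theorem restrictCocycle_apply {n : ℕ} (F : cocycles k (borelSubalgebra N k) k n) :
    restrictCocycle N k n F =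
      exteriorPower.alternatingMapLinearEquiv (restrictCartan N k n F.val) := rfl

theorem restrictCocycle_surjective (n : ℕ) : Function.Surjective (restrictCocycle N k n) := by
  intro f
  let G := exteriorPower.alternatingMapLinearEquiv.symm f
  refine ⟨⟨G.compLinearMap (borelToCartan N k), compLinearMap_borelToCartan_mem_cocycles G⟩, ?_⟩
  rw [restrictCocycle_apply, ← LinearEquiv.eq_symm_apply]
  refine AlternatingMap.ext fun h => ?_
  simp only [restrictCartan_apply, AlternatingMap.compLinearMap_apply, borelToCartan_inclusion, G]

theorem ker_restrictCocycle (hk : ∀ c : ℕ, 0 < c → c ≤ N → (c : k) ≠ 0) (n : ℕ) :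
    LinearMap.ker (restrictCocycle N k n) = (coboundaries k (borelSubalgebra N k) k n).submoduleOf
      (cocycles k (borelSubalgebra N k) k n) := by
  ext F
  rw [LinearMap.mem_ker, Submodule.submoduleOf, Submodule.mem_comap, restrictCocycle_apply,
    LinearEquiv.map_eq_zero_iff]
  exact ⟨mem_coboundaries_of_restrictCartan_eq_zero hk F.2,
    restrictCartan_eq_zero_of_mem_coboundaries⟩

end

/-- Restriction of cocycles to the Cartan subalgebra induces an isomorphism from the cohomology of
the Borel subalgebra with trivial coefficients to the dual of the exterior power of the Cartan
subalgebra. -/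
theorem theorem2 (N : ℕ) (k : Type*) [Field k] (p : ℕ) [CharP k p] (hp : p = 0 ∨ N < p) (n : ℕ) :
    ∃ e : LieCohomology.Cohomology k (borelSubalgebra N k) k n ≃ₗ[k]
        Module.Dual k (⋀[k]^n (cartanSubalgebra N k)),
      ∀ (F : LieCohomology.cocycles k (borelSubalgebra N k) k n) (h : Fin n → cartanSubalgebra N k),
        e (Submodule.Quotient.mk F) (exteriorPower.ιMulti k n h) =
          F.val (fun i =>
            LieSubalgebra.inclusion (cartanSubalgebra_le_borelSubalgebra N k) (h i)) := by
  obtain ⟨e, he⟩ := LinearMap.exists_quotientEquiv_of_surjective (K := k)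
    (V := LieCohomology.cocycles k (borelSubalgebra N k) k n) (f := restrictCocycle N k n)
    (restrictCocycle_surjective n)
    (B := (LieCohomology.coboundaries k (borelSubalgebra N k) k n).submoduleOf
      (LieCohomology.cocycles k (borelSubalgebra N k) k n))
    (ker_restrictCocycle (natCast_ne_zero_of_le (k := k) p hp) n)
  refine ⟨e, fun F h => ?_⟩
  refine (DFunLike.congr_fun (he F) _).trans ?_
  rw [restrictCocycle_apply, exteriorPower.alternatingMapLinearEquiv_apply_ιMulti,
    restrictCartan_apply]
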